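/- Let $\mathbb{N}=\{0,1,2,\dots\}$, let $f_0=f_1=1$, $f_i=f_{i-1}+f_{i-2}$ for $i\ge 2$, and let $\tau=(1+\sqrt5)/2$. **2-partitions.** A 2-partition is a finite set $I=\{i_1<\dots<i_q\}$ of positive integers ($q\ge 0$) with $i_{a+1}-i_a\ge 2$; put $f_I=f_{i_1}+\dots+f_{i_q}$. For $n\in\mathbb{N}$ let $Z(n)=\{\mu_1(n)<\dots<\mu_q(n)\}$ be the unique 2-partition with $f_{Z(n)}=n$ (Zeckendorf). **Multivectors.** For $m\ge 1$ let $\mathcal{A}_m$ be the set of nonempty integer vectors $(\alpha_1,\dots,\alpha_q)$ with $\alpha_1\ge m$ and $\alpha_2,\dots,\alpha_q\ge 2$. For a 2-partition $I$ let $\alpha(I)=(\alpha_1,\dots,\alpha_q)$ with $\alpha_1=\lfloor (i_1-1)/2\rfloor+1$ and $\alpha_r=\lfloor (i_r-i_{r-1})/2\rfloor+1$ for $r>1$. Cut $I$ into consecutive blocks $I_1,\dots,I_s$ exactly between those neighbours $i_{r-1},i_r$ that have different parity, and let $\mathcal{V}(I)=A_1\times\dots\times A_s$ be the sequence of the corresponding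 consecutive blocks of $\alpha(I)$ (empty for $I=\emptyset$). **Continued fractions and the projection $\pi$.** For $A=(\alpha_1,\dots,\alpha_q)\in\mathcal{A}_1$ put $$\langle A\rangle=\cfrac{1}{\alpha_1-\cfrac{1}{\alpha_2-\cdots-\cfrac{1}{\alpha_q}}}.$$ For each rational $g>0$ there is a unique $c(g)\in\mathcal{A}_1$ with $\langle c(g)\rangle=g$. Let $\Gamma$ be the free monoid on the nonzero elements of $\mathbb{Q}/\mathbb{Z}$, identified with the rational numbers in $(0,1)$; its elements are the words $\gamma=g_1*\dots*g_s$ with $s\ge 0$, the empty word being the unit $1$. For $\gamma=g_1*\dots*g_s$ let $c(\gamma)=c(g_1)\times\dots\times c(g_s)$. Define $\pi:\mathbb{N}\to\Gamma$ by $\pi(0)=1$ and, if $n>0$ and $\mathcal{V}(Z(n))=A_1\times\dots\times A_s$, $$\pi(n)=\big(\langle A_1\rangle-\lfloor\langle A_1\rangle\rfloor\big)*\langle A_2\rangle*\dots*\langle A_s\rangle,$$ where the first letter is omitted if it equals $0$. For $\gamma\in\Gamma$ let $\theta(\gamma)$ be the least element of $\pi^{-1}(\gamma)$. A number $n\in\mathbb{N}$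 is called *essential* if $n=\theta(\gamma)$ for some $\gamma\in\Gamma$. **The map $\varepsilon$.** Put $d(\alpha_1,\dots,\alpha_q)=\alpha_1+\dots+\alpha_q-q$ and $$\varepsilon(\alpha_1,\dots,\alpha_q)=\{2d(\alpha_1)+1,\;2d(\alpha_1,\alpha_2)+1,\;\dots,\;2d(\alpha_1,\dots,\alpha_q)+1\},$$ and let $\varepsilon(A_1\times\dots\times A_s)$ be the union over $j=1,\dots,s$ of the sets $\varepsilon(A_j)$ shifted by $2d(A_1)+\dots+2d(A_{j-1})+(j-1)$. **Theorem 3.4.** (a) Let $\gamma=g_1*\dots*g_s\in\Gamma$ with $s\ne 0$. Then $\pi^{-1}(\gamma)$ is nonempty and $\theta(\gamma)=f_{\varepsilon(c(\gamma))}$. (b) A number $n\in\mathbb{N}$ is essential if and only if either $n=0$, or $\mu_1(n)$ is odd and $\mu_1(n)\ge 3$. (c) A number $n\in\mathbb{N}$ is essential if and only if $n=\lfloor m\tau\rfloor+\lfloor m\tau^2\rfloor$ for some $m\in\mathbb{N}$. -/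

import Mathlib

namespace FibPart

/-- The Fibonacci numbers in the indexing `f 0 = f 1 = 1`, `f i = f (i - 1) + f (i - 2)`. -/
def f (i : ℕ) : ℕ := Nat.fib (i + 1)

/-- `fSum [i₁, …, i_q] = f i₁ + ⋯ + f i_q`. -/
def fSum (I : List ℕ) : ℕ := (I.map f).sum

/-- 2-partitions, as increasing lists of positive integers with consecutive gaps at least `2`. -/
def IsTwoPartition (I : List ℕ) : Prop :=
  (∀ i ∈ I, 0 < i) ∧ I.IsChain (fun a b => a + 2 ≤ b)

/-- `Z n` is the increasing list of Zeckendorf indices of `n`. Mathlib's `Nat.zeckendorf n` is the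
decreasing list of indices with respect to `Nat.fib`, where `f i = Nat.fib (i + 1)`. -/
def Z (n : ℕ) : List ℕ := (n.zeckendorf.map (fun k => k - 1)).reverse

/-- The smallest Zeckendorf index of `n` (with value `0` for `n = 0`). -/
def mu₁ (n : ℕ) : ℕ := (Z n).headD 0

/-- The canonical form `(I₁; …; I_s)` of a 2-partition `I`: it is cut exactly between those
neighbours that have different parity. -/
def canonicalForm (I : List ℕ) : List (List ℕ) :=
  I.splitBy (fun a b => a % 2 == b % 2)

/-- `⌊(i₁ - prev)/2⌋ + 1, ⌊(i₂ - i₁)/2⌋ + 1, …, ⌊(i_q - i_{q-1})/2⌋ + 1`. -/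
def assocAux : ℕ → List ℕ → List ℕ
  | _, [] => []
  | prev, i :: l => ((i - prev) / 2 + 1) :: assocAux i l

/-- The associated vector `α(I)`; its first entry is `⌊(i₁ - 1)/2⌋ + 1`. -/
def assocVec (I : List ℕ) : List ℕ := assocAux 1 I

/-- The associated multivector `𝒱(I) = A₁ × ⋯ × A_s`: the vector `α(I)`, cut into consecutive
blocks whose lengths are those of the simple components of `I`. -/
def multiVec (I : List ℕ) : List (List ℕ) :=
  ((canonicalForm I).map List.length).splitLengths (assocVec I)

/-- The set `𝒜_m` of nonempty integer vectors `(α₁, …, α_q)` with `α₁ ≥ m` and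
`α₂, …, α_q ≥ 2`. -/
def VecSet (m : ℕ) : Set (List ℕ) :=
  {A | ∃ a l, A = a :: l ∧ m ≤ a ∧ ∀ b ∈ l, 2 ≤ b}

/-- The continued fraction `⟨α₁, …, α_q⟩ = 1/(α₁ - 1/(α₂ - ⋯ - 1/α_q))`. -/
def cfrac : List ℕ → ℚ
  | [] => 0
  | a :: l => 1 / ((a : ℚ) - cfrac l)

/-- The monoid `Γ(ℚ/ℤ)`, free on the nonzero elements of `ℚ/ℤ`; each of these is identified with
its unique representative in `(0,1)`. -/
abbrev Gam : Type := FreeMonoid (Set.Ioo (0 : ℚ) 1)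

/-- The word of length one given by `g ∈ (0,1)`; the value `0`, which represents the zero class of
`ℚ/ℤ`, gives the unit (the empty word). Only used for `0 ≤ g < 1`. -/
def letter (g : ℚ) : Gam :=
  if h : 0 < g ∧ g < 1 then FreeMonoid.of ⟨g, h⟩ else 1

/-- `p(A₁ × ⋯ × A_s) = (⟨A₁⟩ - ⌊⟨A₁⟩⌋) * ⟨A₂⟩ * ⋯ * ⟨A_s⟩`, and `p` of the empty multivector is
the unit. -/
def p : List (List ℕ) → Gam
  | [] => 1
  | A :: L => letter (Int.fract (cfrac A)) * (L.map (fun B => letter (cfrac B))).prod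

/-- The projection `π : ℕ → Γ(ℚ/ℤ)`, the composition of `Z`, `𝒱` and `p`. -/
def proj (n : ℕ) : Gam := p (multiVec (Z n))

/-- Essential numbers: the least elements of the fibers of `π`. -/
def IsEssential (n : ℕ) : Prop := ∃ γ : Gam, IsLeast (proj ⁻¹' {γ}) n

/-- `d(α₁, …, α_q) = α₁ + ⋯ + α_q - q`. -/
def d (A : List ℕ) : ℕ := A.sum - A.length

/-- `ε(α₁, …, α_q) = {2 d(α₁) + 1, 2 d(α₁, α₂) + 1, …, 2 d(α₁, …, α_q) + 1}`. -/
def epsVec (A : List ℕ) : List ℕ :=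
  (List.range A.length).map (fun j => 2 * d (A.take (j + 1)) + 1)

/-- `ε` of a multivector, with all parts shifted by `s`. -/
def epsAux : ℕ → List (List ℕ) → List ℕ
  | _, [] => []
  | s, A :: L => (epsVec A).map (fun i => i + s) ++ epsAux (s + 2 * d A + 1) L

/-- `ε(A₁ × ⋯ × A_s)`: the union of the sets `ε(A_j)`, the `j`-th one shifted by
`2 d(A₁) + ⋯ + 2 d(A_{j-1}) + (j - 1)`. -/
def eps (L : List (List ℕ)) : List ℕ := epsAux 0 L

theorem cfrac_mem_Ico {l : List ℕ} (h : ∀ b ∈ l, 2 ≤ b) : 0 ≤ cfrac l ∧ cfrac l < 1 := by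
  induction l with
  | nil => simp [cfrac]
  | cons a l ih =>
    obtain ⟨h0, h1⟩ := ih (fun b hb => h b (List.mem_cons_of_mem _ hb))
    have ha : (2 : ℚ) ≤ a := by exact_mod_cast h a List.mem_cons_self
    have hpos : (1 : ℚ) < a - cfrac l := by linarith
    refine ⟨?_, ?_⟩
    · simp only [cfrac]
      exact (div_pos one_pos (by linarith)).le
    · simp only [cfrac]
      rw [div_lt_one (by linarith)]
      exact hpos

theorem cfrac_cons_pos {a : ℕ} {l : List ℕ} (ha : 1 ≤ a) (h : ∀ b ∈ l, 2 ≤ b) :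
    0 < (a : ℚ) - cfrac l ∧ 0 < cfrac (a :: l) := by
  have h1 := (cfrac_mem_Ico h).2
  have ha' : (1 : ℚ) ≤ a := by exact_mod_cast ha
  have hp : 0 < (a : ℚ) - cfrac l := by linarith
  exact ⟨hp, by simp only [cfrac]; exact div_pos one_pos hp⟩

theorem cfrac_inj_aux : ∀ (l m : List ℕ), (∀ b ∈ l, 2 ≤ b) → (∀ b ∈ m, 2 ≤ b) →
    cfrac l = cfrac m → l = m
  | [], [], _, _, _ => rfl
  | [], b :: m, _, hm, h => by
    have := (cfrac_cons_pos (l := m) (le_trans one_le_two (hm b List.mem_cons_self))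
      (fun c hc => hm c (List.mem_cons_of_mem _ hc))).2
    rw [← h] at this
    simp [cfrac] at this
  | a :: l, [], hl, _, h => by
    have := (cfrac_cons_pos (l := l) (le_trans one_le_two (hl a List.mem_cons_self))
      (fun c hc => hl c (List.mem_cons_of_mem _ hc))).2
    rw [h] at this
    simp [cfrac] at this
  | a :: l, b :: m, hl, hm, h => by
    have hl' : ∀ c ∈ l, 2 ≤ c := fun c hc => hl c (List.mem_cons_of_mem _ hc)
    have hm' : ∀ c ∈ m, 2 ≤ c := fun c hc => hm c (List.mem_cons_of_mem _ hc)
    have e : (a : ℚ) - cfrac l = b - cfrac m := by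
      simpa [cfrac] using h
    have ⟨hl0, hl1⟩ := cfrac_mem_Ico hl'
    have ⟨hm0, hm1⟩ := cfrac_mem_Ico hm'
    have hab : a = b := by
      have h1 : (a : ℚ) < b + 1 := by linarith
      have h2 : (b : ℚ) < a + 1 := by linarith
      have h1' : a < b + 1 := by exact_mod_cast h1
      have h2' : b < a + 1 := by exact_mod_cast h2
      omega
    subst hab
    rw [cfrac_inj_aux l m hl' hm' (by linarith)]

theorem exists_cfrac_aux : ∀ (n a b : ℕ), a ≤ n → 0 < a → 0 < b →
    ∃ A ∈ VecSet 1, cfrac A = (a : ℚ) / b ∧ (a < b → A ∈ VecSet 2) := by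
  intro n
  induction n with
  | zero => intro a b h1 h2; omega
  | succ n ih =>
    intro a b han ha hb
    have hadd : b = a * ((b - 1) / a) + (b - 1) % a + 1 := by
      have := Nat.div_add_mod (b - 1) a
      omega
    have hr : (b - 1) % a < a := Nat.mod_lt _ ha
    generalize hk : (b - 1) / a = k at hadd
    generalize hm : (b - 1) % a = r at hadd hr
    have hk1 : a < b → 1 ≤ k := by
      intro hab
      by_contra hc
      have : k = 0 := by omega
      subst this
      omega
    have ha' : (a : ℚ) ≠ 0 := by exact_mod_cast ha.ne'
    have hb' : (b : ℚ) ≠ 0 := by exact_mod_cast hb.ne'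
    have hbq : (b : ℚ) = a * k + r + 1 := by exact_mod_cast hadd
    by_cases h0 : r + 1 = a
    · refine ⟨[k + 1], ⟨k + 1, [], rfl, by omega, by simp⟩, ?_,
        fun hab => ⟨k + 1, [], rfl, by have := hk1 hab; omega, by simp⟩⟩
      have h0q : (r : ℚ) + 1 = a := by exact_mod_cast h0
      have e : (b : ℚ) = a * (k + 1) := by rw [hbq, ← h0q]; ring
      have hk0 : (k : ℚ) + 1 ≠ 0 := by positivity
      simp only [cfrac]
      rw [e]
      push_cast
      field_simp
      ring
    · obtain ⟨l, hl1, hl, hl2⟩ := ih (a - (r + 1)) a (by omega) (by omega) ha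
      obtain ⟨c, t, rfl, hc, ht⟩ := hl2 (by omega)
      have hall : ∀ x ∈ c :: t, 2 ≤ x := by
        intro x hx
        rcases List.mem_cons.1 hx with rfl | hx
        · exact hc
        · exact ht x hx
      refine ⟨(k + 1) :: c :: t, ⟨k + 1, _, rfl, by omega, hall⟩, ?_,
        fun hab => ⟨k + 1, _, rfl, by have := hk1 hab; omega, hall⟩⟩
      have e : ((a - (r + 1) : ℕ) : ℚ) = a - (r + 1) := by
        rw [Nat.cast_sub (by omega)]; push_cast; ring
      have : cfrac ((k + 1) :: c :: t) = 1 / (((k + 1 : ℕ) : ℚ) - cfrac (c :: t)) := rfl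
      rw [this, hl, e]
      have : ((k + 1 : ℕ) : ℚ) - ((a : ℚ) - (r + 1)) / a = b / a := by
        rw [hbq]; push_cast; field_simp; ring
      rw [this, one_div_div]

/-- Every positive rational number has a unique expansion `⟨A⟩` with `A ∈ 𝒜₁`. -/
theorem existsUnique_cfrac (g : ℚ) (hg : 0 < g) : ∃! A, A ∈ VecSet 1 ∧ cfrac A = g := by
  have hnum : 0 < g.num := Rat.num_pos.2 hg
  obtain ⟨A, hA, hAg, -⟩ := exists_cfrac_aux g.num.toNat g.num.toNat g.den le_rfl
    (by omega) g.den_pos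
  have e : ((g.num.toNat : ℕ) : ℚ) = (g.num : ℚ) := by
    have : ((g.num.toNat : ℕ) : ℤ) = g.num := Int.toNat_of_nonneg hnum.le
    exact_mod_cast this
  rw [e, Rat.num_div_den] at hAg
  refine ⟨A, ⟨hA, hAg⟩, ?_⟩
  rintro B ⟨hB, hBg⟩
  obtain ⟨a, l, rfl, ha, hl⟩ := hA
  obtain ⟨b, m, rfl, hb, hm⟩ := hB
  have e2 : (b : ℚ) - cfrac m = a - cfrac l := by
    simpa [cfrac] using hBg.trans hAg.symm
  have ⟨hl0, hl1⟩ := cfrac_mem_Ico hl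
  have ⟨hm0, hm1⟩ := cfrac_mem_Ico hm
  have hab : a = b := by
    have h1 : (a : ℚ) < b + 1 := by linarith
    have h2 : (b : ℚ) < a + 1 := by linarith
    have h1' : a < b + 1 := by exact_mod_cast h1
    have h2' : b < a + 1 := by exact_mod_cast h2
    omega
  subst hab
  rw [cfrac_inj_aux m l hm hl (by linarith)]

/-- `c(g)` is the unique vector in `𝒜₁` with `⟨c(g)⟩ = g`. -/
noncomputable def code (g : Set.Ioo (0 : ℚ) 1) : List ℕ :=
  (existsUnique_cfrac g.1 g.2.1).choose

theorem code_spec (g : Set.Ioo (0 : ℚ) 1) : code g ∈ VecSet 1 ∧ cfrac (code g) = g :=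
  (existsUnique_cfrac g.1 g.2.1).choose_spec.1

/-- `c(g₁ * ⋯ * g_s) = c(g₁) × ⋯ × c(g_s)`. -/
noncomputable def codeWord (γ : Gam) : List (List ℕ) := (FreeMonoid.toList γ).map code

/-- `Z n` is a 2-partition with `f_{Z n} = n`. -/
theorem Z_spec (n : ℕ) : IsTwoPartition (Z n) ∧ fSum (Z n) = n := by
  have h : (n.zeckendorf ++ [0]).IsChain (fun a b => b + 2 ≤ a) := Nat.isZeckendorfRep_zeckendorf n
  have htr : IsTrans ℕ (fun a b => b + 2 ≤ a) := ⟨fun a b c h1 h2 => by omega⟩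
  have hp := List.isChain_iff_pairwise.1 h
  rw [List.pairwise_append] at hp
  have h2 : ∀ k ∈ n.zeckendorf, 2 ≤ k := fun k hk => by simpa using hp.2.2 k hk 0 (by simp)
  refine ⟨⟨?_, ?_⟩, ?_⟩
  · intro i hi
    simp only [Z, List.mem_reverse, List.mem_map] at hi
    obtain ⟨k, hk, rfl⟩ := hi
    have := h2 k hk
    omega
  · apply List.Pairwise.isChain
    rw [Z, List.pairwise_reverse, List.pairwise_map]
    refine hp.1.imp_of_mem ?_
    intro a b ha hb hab
    have := h2 a ha
    have := h2 b hb
    omega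
  · have : (n.zeckendorf.map (fun k => f (k - 1))) = n.zeckendorf.map Nat.fib := by
      apply List.map_congr_left
      intro k hk
      have := h2 k hk
      simp only [f]
      congr 1
      omega
    rw [fSum, Z, List.map_reverse, List.sum_reverse, List.map_map]
    change (n.zeckendorf.map (fun k => f (k - 1))).sum = n
    rw [this, Nat.sum_zeckendorf_fib]

end FibPart

/-! The maps `multiVec` and `eps` are almost inverse. Always `multiVec (eps L) = L`, while `eps
(multiVec I)` is `I` if the first index is odd and `I` moved down by 1 if it is even. So among
2-partitions with a given multivector, the one produced by `eps` has the least sum.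

Passing from multivectors to words loses only the integer part of ⟨A₁⟩. As ⟨1⟩ = 1 and ⟨1, b, …⟩ =
⟨b - 1, …⟩ + 1, leading 1s can be stripped without changing the word, and this does not increase the
sum (`fSum_eps_codeWord_le`). What remains is the unique multivector of the word with all entries at
least 2, its code; this gives (a). The ε-images of such multivectors are exactly the 2-partitions
that are empty or start with an odd index at least 3; this gives (b).

For (c), let x = -ψ = 1/τ. The sum of ψ^(i+1) over Z(n) is -τn modulo 1. Its leading term dominates
(`conjSum_bounds`), so the condition in (b) says that this class meets [0, x³). If a = ⌊mτ⌋, then n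
= ⌊mτ⌋ + ⌊mτ²⌋ means n = 2a + m, and 2m + 3a - τn = x³(mτ - a) with mτ - a in [0, 1). -/

namespace FibPart

/-! ### Cutting a list into blocks -/

theorem splitBy_cons_cons_of_false {α : Type*} {r : α → α → Bool} {i j : α} (l : List α)
    (h : r i j = false) : (i :: j :: l).splitBy r = [i] :: (j :: l).splitBy r := by
  have := List.splitBy_append (r := r) (l := [i]) (m := j :: l) (by simpa using h)
  simpa [List.splitBy_of_isChain] using this

/-- The first block of the tail starts with `j`, so prefixing `i` keeps it a chain; its last
element, and hence the cut after it, is unchanged. -/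
theorem splitBy_cons_cons_of_true {α : Type*} {r : α → α → Bool} {i j : α} (l : List α)
    (h : r i j = true) : ∃ B Bs, (j :: l).splitBy r = B :: Bs ∧
      (i :: j :: l).splitBy r = (i :: B) :: Bs := by
  obtain ⟨B, Bs, hB⟩ := List.exists_cons_of_ne_nil
    (List.splitBy_ne_nil (r := r).2 (List.cons_ne_nil j l))
  refine ⟨B, Bs, hB, ?_⟩
  obtain ⟨h1, h2, h3, h4⟩ := List.splitBy_eq_iff.1 hB
  have hne : B ≠ [] := by rintro rfl; simp at h2
  obtain ⟨b, B, rfl⟩ := List.exists_cons_of_ne_nil hne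
  simp only [List.flatten_cons, List.cons_append, List.cons.injEq] at h1
  obtain ⟨rfl, h1⟩ := h1
  refine List.splitBy_eq_iff.2 ⟨by simp [h1], by simpa using h2, ?_, ?_⟩
  · intro m hm
    rcases List.mem_cons.1 hm with rfl | hm
    · exact (h3 _ List.mem_cons_self).cons_cons h
    · exact h3 m (List.mem_cons_of_mem _ hm)
  · rw [List.isChain_cons] at h4 ⊢
    refine ⟨fun y hy => ?_, h4.2⟩
    obtain ⟨ha, hb, hr⟩ := h4.1 y hy
    exact ⟨by simp, hb, by simpa using hr⟩

/-- The associated multivector of a list of indices, relative to a preceding index. -/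
def multiVecFrom (prev : ℕ) (I : List ℕ) : List (List ℕ) :=
  ((canonicalForm I).map List.length).splitLengths (assocAux prev I)

theorem multiVec_eq (I : List ℕ) : multiVec I = multiVecFrom 1 I := rfl

theorem multiVecFrom_nil (prev : ℕ) : multiVecFrom prev [] = [] := by
  simp [multiVecFrom, canonicalForm]

theorem multiVecFrom_singleton (prev i : ℕ) :
    multiVecFrom prev [i] = [[(i - prev) / 2 + 1]] := by
  simp [multiVecFrom, canonicalForm, assocAux, List.splitBy_of_isChain]

theorem multiVecFrom_of_parity_ne {i j : ℕ} (prev : ℕ) (l : List ℕ) (h : i % 2 ≠ j % 2) :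
    multiVecFrom prev (i :: j :: l) = [(i - prev) / 2 + 1] :: multiVecFrom i (j :: l) := by
  have := splitBy_cons_cons_of_false (r := fun a b : ℕ => a % 2 == b % 2) l (by simpa using h)
  simp [multiVecFrom, canonicalForm, assocAux, this]

theorem multiVecFrom_of_parity_eq {i j : ℕ} (prev : ℕ) (l : List ℕ) (h : i % 2 = j % 2) :
    ∃ A L, multiVecFrom i (j :: l) = A :: L ∧
      multiVecFrom prev (i :: j :: l) = (((i - prev) / 2 + 1) :: A) :: L := by
  obtain ⟨B, Bs, h1, h2⟩ :=
    splitBy_cons_cons_of_true (r := fun a b : ℕ => a % 2 == b % 2) l (by simpa using h)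
  refine ⟨(assocAux i (j :: l)).take B.length,
    (Bs.map List.length).splitLengths ((assocAux i (j :: l)).drop B.length), ?_, ?_⟩
  · simp [multiVecFrom, canonicalForm, h1]
  · simp [multiVecFrom, canonicalForm, h2, assocAux]

/-! ### Multivectors -/

/-- `IsMultiVec m (A₁ × ⋯ × A_s)` says that `A₁ ∈ 𝒜_m` and `A₂, …, A_s ∈ 𝒜₂`. -/
inductive IsMultiVec : ℕ → List (List ℕ) → Prop
  | nil (m : ℕ) : IsMultiVec m []
  | single {m a : ℕ} {L : List (List ℕ)} :
      m ≤ a → IsMultiVec 2 L → IsMultiVec m ([a] :: L)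
  | cons {m a b : ℕ} {l : List ℕ} {L : List (List ℕ)} :
      m ≤ a → IsMultiVec 2 ((b :: l) :: L) → IsMultiVec m ((a :: b :: l) :: L)

/-- The constructors peel off one entry at a time, as the recursions for `multiVecFrom` and `epsAux`
do; this recovers the blockwise condition. -/
theorem isMultiVec_cons_iff {m a : ℕ} {l : List ℕ} {L : List (List ℕ)} :
    IsMultiVec m ((a :: l) :: L) ↔ m ≤ a ∧ (∀ b ∈ l, 2 ≤ b) ∧ IsMultiVec 2 L := by
  induction l generalizing m a with
  | nil =>
    refine ⟨fun h => ?_, fun h => .single h.1 h.2.2⟩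
    cases h with
    | single h1 h2 => exact ⟨h1, by simp, h2⟩
  | cons b l ih =>
    refine ⟨fun h => ?_, fun h => .cons h.1 (ih.2 ⟨h.2.1 b (by simp), ?_, h.2.2⟩)⟩
    · cases h with
      | cons h1 h2 =>
        obtain ⟨h3, h4, h5⟩ := ih.1 h2
        exact ⟨h1, by simpa using ⟨h3, h4⟩, h5⟩
    · exact fun c hc => h.2.1 c (by simp [hc])

theorem isMultiVec_of_forall_mem {L : List (List ℕ)} (h : ∀ A ∈ L, A ∈ VecSet 2) :
    IsMultiVec 2 L := by
  induction L with
  | nil => exact .nil 2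
  | cons A L ih =>
    obtain ⟨a, l, rfl, ha, hl⟩ := h A List.mem_cons_self
    exact isMultiVec_cons_iff.2 ⟨ha, hl, ih fun B hB => h B (List.mem_cons_of_mem _ hB)⟩

theorem IsMultiVec.mono {m n : ℕ} {L : List (List ℕ)} (h : IsMultiVec n L) (hmn : m ≤ n) :
    IsMultiVec m L := by
  cases h with
  | nil => exact .nil m
  | single h1 h2 => exact .single (hmn.trans h1) h2
  | cons h1 h2 => exact .cons (hmn.trans h1) h2

/-! ### The map `ε` -/

theorem d_cons {a : ℕ} (A : List ℕ) (ha : 1 ≤ a) (hA : ∀ b ∈ A, 1 ≤ b) :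
    d (a :: A) = (a - 1) + d A := by
  have : A.length ≤ A.sum := by
    exact List.length_le_sum_of_one_le A hA
  simp only [d, List.sum_cons, List.length_cons]
  omega

theorem epsVec_cons {a : ℕ} (A : List ℕ) (ha : 1 ≤ a) (hA : ∀ b ∈ A, 1 ≤ b) :
    epsVec (a :: A) = (2 * (a - 1) + 1) :: (epsVec A).map (fun i => i + 2 * (a - 1)) := by
  simp only [epsVec, List.length_cons, List.range_succ_eq_map, List.map_cons, List.map_map,
    List.cons.injEq]
  refine ⟨by simp [d], List.map_congr_left fun j _ => ?_⟩
  have := d_cons (A.take (j + 1)) ha fun b hb => hA b (List.mem_of_mem_take hb)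
  simp only [Function.comp_apply, Nat.succ_eq_add_one, List.take_succ_cons, this]
  omega

theorem epsAux_single {a : ℕ} (s : ℕ) (L : List (List ℕ)) (ha : 1 ≤ a) :
    epsAux s ([a] :: L) = (s + 2 * (a - 1) + 1) :: epsAux (s + 2 * (a - 1) + 1) L := by
  have h : d [a] = a - 1 := by simp [d]
  simp only [epsAux, epsVec_cons [] ha (by simp), h]
  simp [epsVec]
  omega

/-- Inside a block the new offset is the emitted index minus one, so parity is kept; at the end of a
block (`epsAux_single`) it is the index itself, so parity flips. -/
theorem epsAux_cons {a b : ℕ} {l : List ℕ} (s : ℕ) (L : List (List ℕ)) (ha : 1 ≤ a)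
    (hl : ∀ c ∈ b :: l, 1 ≤ c) :
    epsAux s ((a :: b :: l) :: L) =
      (s + 2 * (a - 1) + 1) :: epsAux (s + 2 * (a - 1)) ((b :: l) :: L) := by
  simp only [epsAux, epsVec_cons _ ha hl, d_cons _ ha hl, List.map_cons, List.map_map,
    List.cons_append, List.cons.injEq]
  refine ⟨by omega, ?_⟩
  congr 1
  · apply List.map_congr_left
    intro i _
    simp only [Function.comp_apply]
    omega
  · congr 1
    omega

theorem IsMultiVec.epsAux_cons {m a b : ℕ} {l : List ℕ} {L : List (List ℕ)} (hm : 1 ≤ m)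
    (h : m ≤ a) (h' : IsMultiVec 2 ((b :: l) :: L)) (s : ℕ) :
    epsAux s ((a :: b :: l) :: L) =
      (s + 2 * (a - 1) + 1) :: epsAux (s + 2 * (a - 1)) ((b :: l) :: L) := by
  obtain ⟨h1, h2, -⟩ := isMultiVec_cons_iff.1 h'
  refine FibPart.epsAux_cons s L (hm.trans h) fun c hc => ?_
  rcases List.mem_cons.1 hc with rfl | hc
  · omega
  · have := h2 c hc
    omega

theorem epsAux_add (s k : ℕ) (L : List (List ℕ)) :
    epsAux (s + k) L = (epsAux s L).map (fun i => i + k) := by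
  induction L generalizing s with
  | nil => rfl
  | cons A L ih =>
    simp only [epsAux, List.map_append, List.map_map, ← ih]
    congr 1
    · apply List.map_congr_left
      intro i _
      simp only [Function.comp_apply]
      omega
    · congr 1
      omega

theorem epsAux_eq_map_eps (s : ℕ) (L : List (List ℕ)) :
    epsAux s L = (eps L).map (fun i => i + s) := by
  rw [eps, ← epsAux_add, Nat.zero_add]

theorem IsMultiVec.exists_epsAux_eq_cons {m a : ℕ} {l : List ℕ} {L : List (List ℕ)} (hm : 1 ≤ m)
    (h : IsMultiVec m ((a :: l) :: L)) (s : ℕ) :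
    ∃ I, epsAux s ((a :: l) :: L) = (s + 2 * (a - 1) + 1) :: I := by
  cases h with
  | single h1 h2 => exact ⟨_, epsAux_single s L (hm.trans h1)⟩
  | cons h1 h2 => exact ⟨_, IsMultiVec.epsAux_cons hm h1 h2 s⟩

theorem IsMultiVec.exists_epsAux_eq_cons' {L : List (List ℕ)} (h : IsMultiVec 2 L) (s : ℕ) :
    epsAux s L = [] ∨ ∃ j I, epsAux s L = j :: I ∧ s + 3 ≤ j ∧ j % 2 ≠ s % 2 := by
  rcases L with _ | ⟨_ | ⟨a, l⟩, L⟩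
  · exact .inl rfl
  · cases h
  · obtain ⟨I, hI⟩ := h.exists_epsAux_eq_cons one_le_two s
    have := (isMultiVec_cons_iff.1 h).1
    exact .inr ⟨_, I, hI, by omega, by omega⟩

theorem IsMultiVec.isChain_epsAux {m : ℕ} {L : List (List ℕ)} (h : IsMultiVec m L) (hm : 1 ≤ m)
    (s : ℕ) : (epsAux s L).IsChain (fun a b => a + 2 ≤ b) := by
  induction h generalizing s with
  | nil => exact .nil
  | @single m a L h1 h2 ih =>
    rw [epsAux_single s L (hm.trans h1)]
    have hc := ih one_le_two (s + 2 * (a - 1) + 1)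
    rcases h2.exists_epsAux_eq_cons' (s + 2 * (a - 1) + 1) with h3 | ⟨j, I, h3, h4, -⟩
    · rw [h3]; exact .singleton _
    · rw [h3] at hc ⊢
      exact hc.cons_cons (by omega)
  | @cons m a b l L h1 h2 ih =>
    rw [IsMultiVec.epsAux_cons hm h1 h2]
    have hc := ih one_le_two (s + 2 * (a - 1))
    obtain ⟨I, hI⟩ := h2.exists_epsAux_eq_cons one_le_two (s + 2 * (a - 1))
    have := (isMultiVec_cons_iff.1 h2).1
    rw [hI] at hc ⊢
    exact hc.cons_cons (by omega)

theorem IsMultiVec.isTwoPartition_eps {m : ℕ} {L : List (List ℕ)} (h : IsMultiVec m L)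
    (hm : 1 ≤ m) : IsTwoPartition (eps L) := by
  refine ⟨fun i hi => ?_, h.isChain_epsAux hm 0⟩
  have hc := h.isChain_epsAux hm 0
  rcases L with _ | ⟨_ | ⟨a, l⟩, L⟩
  · simp [eps, epsAux] at hi
  · cases h
  · obtain ⟨I, hI⟩ := h.exists_epsAux_eq_cons hm 0
    have htr : IsTrans ℕ (fun a b => a + 2 ≤ b) := ⟨fun a b c h1 h2 => by omega⟩
    rw [hI, List.isChain_iff_pairwise, List.pairwise_cons] at hc
    rw [eps, hI] at hi
    rcases List.mem_cons.1 hi with rfl | hi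
    · omega
    · have := hc.1 i hi
      omega

/-- The previous index equals the offset after a finished block, and the offset plus one inside a
block. The next index exceeds `s` by an odd number, so the halved gap is the same in both cases. -/
theorem IsMultiVec.multiVecFrom_epsAux {m : ℕ} {L : List (List ℕ)} (h : IsMultiVec m L)
    (hm : 1 ≤ m) {s prev : ℕ} (hs : prev = s ∨ prev = s + 1) :
    multiVecFrom prev (epsAux s L) = L := by
  induction h generalizing s prev with
  | nil => simp [epsAux, multiVecFrom_nil]
  | @single m a L h1 h2 ih =>
    rw [epsAux_single s L (hm.trans h1)]
    have ih := ih one_le_two (s := s + 2 * (a - 1) + 1) (.inl rfl)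
    have ha : (s + 2 * (a - 1) + 1 - prev) / 2 + 1 = a := by omega
    rcases h2.exists_epsAux_eq_cons' (s + 2 * (a - 1) + 1) with h3 | ⟨j, I, h3, -, h4⟩
    · rw [h3, multiVecFrom_nil] at ih
      rw [h3, ← ih, multiVecFrom_singleton, ha]
    · rw [h3] at ih ⊢
      rw [multiVecFrom_of_parity_ne _ _ h4.symm, ih, ha]
  | @cons m a b l L h1 h2 ih =>
    rw [IsMultiVec.epsAux_cons hm h1 h2]
    have ih := ih one_le_two (s := s + 2 * (a - 1)) (.inr rfl)
    have ha : (s + 2 * (a - 1) + 1 - prev) / 2 + 1 = a := by omega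
    obtain ⟨I, hI⟩ := h2.exists_epsAux_eq_cons one_le_two (s + 2 * (a - 1))
    rw [hI] at ih ⊢
    obtain ⟨A, L', h3, h4⟩ := multiVecFrom_of_parity_eq (i := s + 2 * (a - 1) + 1)
      (j := s + 2 * (a - 1) + 2 * (b - 1) + 1) prev I (by omega)
    rw [h4, ha]
    rw [ih] at h3
    simp only [List.cons.injEq] at h3 ⊢
    exact ⟨⟨trivial, h3.1.symm⟩, h3.2.symm⟩

theorem multiVec_eps {m : ℕ} {L : List (List ℕ)} (h : IsMultiVec m L) (hm : 1 ≤ m) :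
    multiVec (eps L) = L :=
  h.multiVecFrom_epsAux hm (.inr rfl)

theorem isMultiVec_multiVecFrom {i : ℕ} {I : List ℕ}
    (h : (i :: I).IsChain (fun a b => a + 2 ≤ b)) {m prev : ℕ} (hi : m ≤ (i - prev) / 2 + 1) :
    IsMultiVec m (multiVecFrom prev (i :: I)) := by
  induction I generalizing i m prev with
  | nil => rw [multiVecFrom_singleton]; exact .single hi (.nil 2)
  | cons j I ih =>
    rw [List.isChain_cons_cons] at h
    have ih := ih h.2 (m := 2) (prev := i) (by omega)
    by_cases hp : i % 2 = j % 2
    · obtain ⟨A, L, h1, h2⟩ := multiVecFrom_of_parity_eq prev I hp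
      rw [h1] at ih
      rw [h2]
      rcases A with _ | ⟨a, A⟩
      · cases ih
      · exact .cons hi ih
    · rw [multiVecFrom_of_parity_ne _ _ hp]
      exact .single hi ih

theorem isMultiVec_multiVec {I : List ℕ} (h : IsTwoPartition I) : IsMultiVec 1 (multiVec I) := by
  rcases I with _ | ⟨i, I⟩
  · rw [multiVec_eq, multiVecFrom_nil]; exact .nil 1
  · exact isMultiVec_multiVecFrom h.2 (by omega)

/-- The parity condition `hp` restores the bit lost in halving the gap. It persists: neighbours of
equal parity continue with offset `i - 1`, the others with offset `i`. -/
theorem epsAux_multiVecFrom {i : ℕ} {I : List ℕ}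
    (h : (i :: I).IsChain (fun a b => a + 2 ≤ b)) {s prev : ℕ} (hi : prev ≤ i)
    (hs : prev = s ∨ prev = s + 1) (hp : i % 2 ≠ s % 2) :
    epsAux s (multiVecFrom prev (i :: I)) = i :: I := by
  induction I generalizing i s prev with
  | nil =>
    have : s + 2 * ((i - prev) / 2 + 1 - 1) + 1 = i := by omega
    rw [multiVecFrom_singleton, epsAux_single _ _ (by omega), this]
    rfl
  | cons j I ih =>
    rw [List.isChain_cons_cons] at h
    have hV := isMultiVec_multiVecFrom h.2 (m := 2) (prev := i) (by omega)
    have he : s + 2 * ((i - prev) / 2 + 1 - 1) + 1 = i := by omega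
    by_cases hpar : i % 2 = j % 2
    · obtain ⟨A, L, h1, h2⟩ := multiVecFrom_of_parity_eq prev I hpar
      rw [h1] at hV
      rcases A with _ | ⟨a, A⟩
      · cases hV
      rw [h2, IsMultiVec.epsAux_cons (m := 1) le_rfl (by omega) hV, he, ← h1,
        ih h.2 (by omega) (.inr he.symm) (by omega)]
    · rw [multiVecFrom_of_parity_ne _ _ hpar, epsAux_single _ _ (by omega), he,
        ih h.2 (by omega) (.inl rfl) (Ne.symm hpar)]

theorem eps_multiVec_of_odd {i : ℕ} {I : List ℕ} (h : IsTwoPartition (i :: I)) (hi : Odd i) :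
    eps (multiVec (i :: I)) = i :: I := by
  rw [Nat.odd_iff] at hi
  exact epsAux_multiVecFrom h.2 (by omega) (.inr rfl) (by omega)

theorem map_eps_multiVec_of_even {i : ℕ} {I : List ℕ} (h : IsTwoPartition (i :: I))
    (hi : Even i) : (eps (multiVec (i :: I))).map (fun j => j + 1) = i :: I := by
  rw [Nat.even_iff] at hi
  rw [← epsAux_eq_map_eps]
  have := h.1 i List.mem_cons_self
  exact epsAux_multiVecFrom h.2 (by omega) (.inl rfl) (by omega)

/-! ### Sums of Fibonacci numbers -/

theorem fSum_cons (i : ℕ) (I : List ℕ) : fSum (i :: I) = f i + fSum I := by simp [fSum]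

theorem fSum_le_fSum_map_add (I : List ℕ) (k : ℕ) : fSum I ≤ fSum (I.map (fun i => i + k)) := by
  induction I with
  | nil => simp
  | cons i I ih =>
    rw [List.map_cons, fSum_cons, fSum_cons]
    exact Nat.add_le_add (Nat.fib_mono (by omega)) ih

theorem fSum_eps_multiVec_le {I : List ℕ} (h : IsTwoPartition I) :
    fSum (eps (multiVec I)) ≤ fSum I := by
  rcases I with _ | ⟨i, I⟩
  · simp [multiVec_eq, multiVecFrom_nil, eps, epsAux]
  · rcases Nat.even_or_odd i with hi | hi
    · conv_rhs => rw [← map_eps_multiVec_of_even h hi]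
      exact fSum_le_fSum_map_add _ 1
    · rw [eps_multiVec_of_odd h hi]

/-- Uniqueness of the Zeckendorf representation. -/
theorem Z_fSum {I : List ℕ} (h : IsTwoPartition I) : Z (fSum I) = I := by
  have htr : IsTrans ℕ (fun a b => b + 2 ≤ a) := ⟨fun a b c h1 h2 => by omega⟩
  have htr' : IsTrans ℕ (fun a b => a + 2 ≤ b) := ⟨fun a b c h1 h2 => by omega⟩
  have hz : (I.reverse.map (fun i => i + 1)).IsZeckendorfRep := by
    rw [List.IsZeckendorfRep, List.isChain_iff_pairwise, List.pairwise_append, List.map_reverse,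
      List.pairwise_reverse, List.pairwise_map]
    refine ⟨(List.isChain_iff_pairwise.1 h.2).imp (by omega), by simp, ?_⟩
    intro a ha b hb
    simp only [List.mem_reverse, List.mem_map] at ha
    obtain ⟨i, hi, rfl⟩ := ha
    have := h.1 i hi
    simp only [List.mem_singleton] at hb
    omega
  have hs : ((I.reverse.map (fun i => i + 1)).map Nat.fib).sum = fSum I := by
    rw [List.map_map, List.map_reverse, List.sum_reverse]
    rfl
  rw [Z, ← hs, Nat.zeckendorf_sum_fib hz, List.map_map]
  simp [Function.comp_def]

/-! ### Words and their codes -/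

theorem letter_coe (g : Set.Ioo (0 : ℚ) 1) : letter g.1 = FreeMonoid.of g := by
  rw [letter, dif_pos (show 0 < g.1 ∧ g.1 < 1 from g.2)]

/-- A value below 1 forces the first denominator above 1, and the tail subtracted there is
nonnegative. -/
theorem code_mem_vecSet (g : Set.Ioo (0 : ℚ) 1) : code g ∈ VecSet 2 := by
  obtain ⟨⟨a, l, h1, ha, hl⟩, h2⟩ := code_spec g
  refine ⟨a, l, h1, ?_, hl⟩
  have hg := g.2.2
  rw [← h2, h1, cfrac, div_lt_one (cfrac_cons_pos ha hl).1] at hg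
  have := (cfrac_mem_Ico hl).1
  have h3 : (1 : ℚ) < a := by linarith
  exact_mod_cast h3

theorem cfrac_mem_Ioo {A : List ℕ} (hA : A ∈ VecSet 2) : cfrac A ∈ Set.Ioo (0 : ℚ) 1 := by
  obtain ⟨a, l, rfl, ha, hl⟩ := hA
  exact ⟨(cfrac_cons_pos (one_le_two.trans ha) hl).2,
    (cfrac_mem_Ico (by simpa using ⟨ha, hl⟩)).2⟩

theorem letter_cfrac {A : List ℕ} (hA : A ∈ VecSet 2) :
    letter (cfrac A) = FreeMonoid.of ⟨cfrac A, cfrac_mem_Ioo hA⟩ :=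
  letter_coe ⟨cfrac A, cfrac_mem_Ioo hA⟩

theorem code_cfrac {A : List ℕ} (hA : A ∈ VecSet 2) : code ⟨cfrac A, cfrac_mem_Ioo hA⟩ = A := by
  refine (existsUnique_cfrac (cfrac A) (cfrac_mem_Ioo hA).1).unique (code_spec _) ⟨?_, rfl⟩
  obtain ⟨a, l, h, ha, hl⟩ := hA
  exact ⟨a, l, h, one_le_two.trans ha, hl⟩

theorem codeWord_of_mul (g : Set.Ioo (0 : ℚ) 1) (γ : Gam) :
    codeWord (FreeMonoid.of g * γ) = code g :: codeWord γ := by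
  simp [codeWord]

theorem isMultiVec_codeWord (γ : Gam) : IsMultiVec 2 (codeWord γ) := by
  refine isMultiVec_of_forall_mem fun A hA => ?_
  obtain ⟨g, -, rfl⟩ := List.mem_map.1 hA
  exact code_mem_vecSet g

theorem p_cons (A : List ℕ) (L : List (List ℕ)) (hL : IsMultiVec 2 L) :
    p (A :: L) = letter (Int.fract (cfrac A)) * p L := by
  rcases L with _ | ⟨_ | ⟨b, l⟩, L⟩
  · rfl
  · cases hL
  · obtain ⟨hb, hl, -⟩ := isMultiVec_cons_iff.1 hL
    have h := cfrac_mem_Ioo ⟨b, l, rfl, hb, hl⟩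
    rw [p, p, Int.fract_eq_self.2 ⟨h.1.le, h.2⟩, List.map_cons, List.prod_cons]

theorem p_cons_of_mem {A : List ℕ} (hA : A ∈ VecSet 2) {L : List (List ℕ)}
    (hL : IsMultiVec 2 L) : p (A :: L) = FreeMonoid.of ⟨cfrac A, cfrac_mem_Ioo hA⟩ * p L := by
  have h := cfrac_mem_Ioo hA
  rw [p_cons A L hL, Int.fract_eq_self.2 ⟨h.1.le, h.2⟩, letter_cfrac hA]

theorem p_codeWord (γ : Gam) : p (codeWord γ) = γ := by
  induction γ using FreeMonoid.recOn with
  | one => rfl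
  | of_mul g γ ih =>
    rw [codeWord_of_mul, p_cons_of_mem (code_mem_vecSet g) (isMultiVec_codeWord γ), ih]
    congr 2
    exact Subtype.ext (code_spec g).2

theorem codeWord_p {L : List (List ℕ)} (hL : IsMultiVec 2 L) : codeWord (p L) = L := by
  induction L with
  | nil => rfl
  | cons A L ih =>
    rcases A with _ | ⟨a, l⟩
    · cases hL
    · obtain ⟨ha, hl, hL⟩ := isMultiVec_cons_iff.1 hL
      have hA : a :: l ∈ VecSet 2 := ⟨a, l, rfl, ha, hl⟩
      rw [p_cons_of_mem hA hL, codeWord_of_mul, ih hL, code_cfrac hA]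

/-! ### Minimality -/

/-- With y = b - ⟨l⟩, this is 1/(1 - 1/y) = 1/(y - 1) + 1. -/
theorem cfrac_one_cons {b : ℕ} {l : List ℕ} (hb : 2 ≤ b) (hl : ∀ c ∈ l, 2 ≤ c) :
    cfrac (1 :: b :: l) = cfrac ((b - 1) :: l) + 1 := by
  have hb' : (2 : ℚ) ≤ b := by exact_mod_cast hb
  have h1 := (cfrac_mem_Ico hl).2
  have h2 : (b : ℚ) - 1 - cfrac l ≠ 0 := by linarith
  have h3 : (b : ℚ) - cfrac l ≠ 0 := by linarith
  have h4 : (1 : ℚ) - 1 / (b - cfrac l) ≠ 0 := by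
    rw [one_sub_div h3]
    exact div_ne_zero (by linarith) h3
  simp only [cfrac, Nat.cast_sub (one_le_two.trans hb), Nat.cast_one]
  rw [one_sub_div h3, one_div_div, div_add_one h2]
  congr 1 <;> ring

theorem epsAux_succ_cons {a : ℕ} {l : List ℕ} (s : ℕ) (L : List (List ℕ)) (ha : 1 ≤ a)
    (hl : ∀ c ∈ l, 1 ≤ c) : epsAux s (((a + 1) :: l) :: L) = epsAux (s + 2) ((a :: l) :: L) := by
  have h : s + 2 * (a + 1 - 1) = s + 2 + 2 * (a - 1) := by omega
  rcases l with _ | ⟨b, l⟩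
  · rw [epsAux_single s L (by omega), epsAux_single (s + 2) L ha, h]
  · rw [epsAux_cons s L (by omega) hl, epsAux_cons (s + 2) L ha hl, h]

/-- Each removal of a leading 1 shortens the first vector by one entry, hence the induction on its
length. -/
theorem fSum_eps_codeWord_le {L : List (List ℕ)} (hL : IsMultiVec 1 L) :
    fSum (eps (codeWord (p L))) ≤ fSum (eps L) := by
  rcases L with _ | ⟨A, L⟩
  · rfl
  induction hA : A.length generalizing A with
  | zero =>
    rw [List.length_eq_zero_iff.1 hA] at hL
    cases hL
  | succ n ih =>
    obtain ⟨a, l, rfl⟩ := List.exists_cons_of_length_eq_add_one hA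
    obtain ⟨ha, hl, hL'⟩ := isMultiVec_cons_iff.1 hL
    rcases ha.eq_or_lt with rfl | ha
    · rcases l with _ | ⟨b, l⟩
      · have h0 : p ([1] :: L) = p L := by
          rw [p_cons _ _ hL']
          simp [cfrac, letter]
        rw [h0, codeWord_p hL', eps.eq_1 ([1] :: L), epsAux_single 0 L le_rfl, fSum_cons, epsAux_eq_map_eps]
        exact (fSum_le_fSum_map_add _ _).trans (Nat.le_add_left _ _)
      · have hb := hl b List.mem_cons_self
        have hl' : ∀ c ∈ l, 2 ≤ c := fun c hc => hl c (List.mem_cons_of_mem _ hc)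
        have hM : IsMultiVec 1 (((b - 1) :: l) :: L) :=
          isMultiVec_cons_iff.2 ⟨by omega, hl', hL'⟩
        have h0 : p ((1 :: b :: l) :: L) = p (((b - 1) :: l) :: L) := by
          rw [p_cons _ _ hL', p_cons _ _ hL', cfrac_one_cons hb hl', Int.fract_add_one]
        -- The entry 1 emits the index 1 and leaves the offset at 0; raising `b - 1` to `b` moves
        -- all later indices by 2.
        have hE : eps ((1 :: b :: l) :: L) =
            1 :: (eps (((b - 1) :: l) :: L)).map (fun i => i + 2) := by
          have hb1 : b - 1 + 1 = b := by omega
          have h1 : ∀ c ∈ b :: l, 1 ≤ c := fun c hc => one_le_two.trans (hl c hc)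
          rw [← epsAux_eq_map_eps, ← epsAux_succ_cons 0 L (by omega)
            fun c hc => one_le_two.trans (hl' c hc), hb1, eps, epsAux_cons 0 L le_rfl h1]
        rw [h0, hE, fSum_cons]
        refine (ih _ hM (by simpa using hA)).trans ?_
        exact (fSum_le_fSum_map_add _ _).trans (Nat.le_add_left _ _)
    · rw [codeWord_p (isMultiVec_cons_iff.2 ⟨ha, hl, hL'⟩)]

/-! ### Conjugate Fibonacci sums -/

open Real goldenRatio in
/-- `∑ ψ ^ (i + 1)` over the elements of `I`, where `ψ = -1/τ`. -/
noncomputable def conjSum (I : List ℕ) : ℝ := (I.map (fun i => ψ ^ (i + 1))).sum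

open Real goldenRatio in
theorem exists_conjSum_eq (I : List ℕ) : ∃ s : ℕ, conjSum I = s - φ * fSum I := by
  induction I with
  | nil => exact ⟨0, by simp [conjSum, fSum]⟩
  | cons i I ih =>
    obtain ⟨s, hs⟩ := ih
    refine ⟨Nat.fib (i + 2) + s, ?_⟩
    have h := fib_succ_sub_goldenRatio_mul_fib (i + 1)
    have h1 : conjSum (i :: I) = ψ ^ (i + 1) + conjSum I := by simp [conjSum]
    have h2 : fSum (i :: I) = Nat.fib (i + 1) + fSum I := by simp [fSum, f]
    rw [h1, h2, hs, ← h]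
    push_cast
    ring

open Real goldenRatio in
-- Let x = -ψ, so 1 - x² = x. After the sign is removed the leading term is x^(i+1). Continuing with
-- i+2, i+4, … pushes the sum up towards x^(i+1)/(1 - x²) = x^i; continuing with i+3, i+5, … pushes
-- it down towards x^(i+1) - x^(i+3) = x^(i+2). Finite sums attain neither.
theorem conjSum_bounds {i : ℕ} {I : List ℕ} (h : (i :: I).IsChain (fun a b => a + 2 ≤ b)) :
    (-ψ) ^ (i + 2) < (-1) ^ (i + 1) * conjSum (i :: I) ∧
      (-1) ^ (i + 1) * conjSum (i :: I) < (-ψ) ^ i := by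
  have hx0 : 0 < -ψ := neg_pos.2 goldenConj_neg
  have hx1 : -ψ < 1 := by linarith [neg_one_lt_goldenConj]
  have hx2 : (-ψ) ^ 2 = 1 - (-ψ) := by rw [neg_sq, goldenConj_sq]; ring
  have hpow : ∀ k : ℕ, (-ψ) ^ (k + 2) = (-ψ) ^ k - (-ψ) ^ (k + 1) := fun k => by
    rw [pow_add, hx2]; ring
  have hcons : ∀ (k : ℕ) (J : List ℕ), (-1) ^ (k + 1) * conjSum (k :: J) =
      (-ψ) ^ (k + 1) + (-1) ^ (k + 1) * conjSum J := fun k J => by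
    have : conjSum (k :: J) = ψ ^ (k + 1) + conjSum J := by simp [conjSum]
    rw [this, mul_add, ← mul_pow, neg_one_mul]
  induction I generalizing i with
  | nil =>
    rw [hcons]
    have h0 : conjSum [] = 0 := by simp [conjSum]
    rw [h0, mul_zero, add_zero]
    exact ⟨pow_lt_pow_right_of_lt_one₀ hx0 hx1 (by omega),
      pow_lt_pow_right_of_lt_one₀ hx0 hx1 (by omega)⟩
  | cons j I ih =>
    rw [List.isChain_cons_cons] at h
    obtain ⟨h1, h2⟩ := ih h.2
    rw [hcons i]
    have h3 := hpow i
    have h3' := hpow (i + 1)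
    have h5 : 0 < (-ψ) ^ (j + 2) := pow_pos hx0 _
    have h6 : (-ψ) ^ j ≤ (-ψ) ^ (i + 2) := pow_le_pow_of_le_one hx0.le hx1.le h.1
    rcases Nat.even_or_odd (i + j) with hij | hij
    · have h7 : ((-1) ^ (i + 1) : ℝ) = (-1) ^ (j + 1) := by
        rcases Nat.even_or_odd i with hi | hi
        · have hj : Even j := by grind
          rw [hi.add_one.neg_one_pow, hj.add_one.neg_one_pow]
        · have hj : Odd j := by grind
          rw [hi.add_one.neg_one_pow, hj.add_one.neg_one_pow]
      have h8 : (-ψ) ^ (i + 2) < (-ψ) ^ (i + 1) :=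
        pow_lt_pow_right_of_lt_one₀ hx0 hx1 (by omega)
      rw [h7]
      constructor <;> linarith
    · have h7 : ((-1) ^ (i + 1) : ℝ) = -(-1) ^ (j + 1) := by
        rcases Nat.even_or_odd i with hi | hi
        · have hj : Odd j := by grind
          rw [hi.add_one.neg_one_pow, hj.add_one.neg_one_pow]
        · have hj : Even j := by grind
          rw [hi.add_one.neg_one_pow, hj.add_one.neg_one_pow, neg_neg]
      -- Opposite parity excludes j = i + 2, so j ≥ i + 3.
      have h8 : (-ψ) ^ j ≤ (-ψ) ^ (i + 1 + 2) := by
        apply pow_le_pow_of_le_one hx0.le hx1.le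
        have := h.1
        have : j ≠ i + 2 := by rintro rfl; grind
        omega
      have h9 : 0 < (-ψ) ^ (i + 2) := pow_pos hx0 _
      rw [h7]
      have h10 : (-ψ) ^ (i + 1) < (-ψ) ^ i :=
        pow_lt_pow_right_of_lt_one₀ hx0 hx1 (by omega)
      have e : i + 1 + 1 = i + 2 := rfl
      rw [e] at h3'
      constructor <;> linarith

open Real goldenRatio in
/-- The integer translates of the conjugate sum meet `[0, τ⁻³)` exactly if the first index is odd
and at least `3`. -/
theorem exists_add_conjSum_mem_iff {I : List ℕ} (h : IsTwoPartition I) :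
    (∃ t : ℤ, t + conjSum I ∈ Set.Ico 0 ((-ψ) ^ 3)) ↔
      I = [] ∨ (Odd (I.headD 0) ∧ 3 ≤ I.headD 0) := by
  have hx0 : 0 < -ψ := neg_pos.2 goldenConj_neg
  have hx1 : -ψ < 1 := by linarith [neg_one_lt_goldenConj]
  have hx2 : (-ψ) ^ 2 = 1 - (-ψ) := by rw [neg_sq, goldenConj_sq]; ring
  have hx3 : (-ψ) ^ 3 = 2 * (-ψ) - 1 := by rw [pow_succ, hx2]; linear_combination -hx2
  have hx4 : 0 < (-ψ) ^ 3 := pow_pos hx0 3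
  rcases I with _ | ⟨i, I⟩
  · simp only [true_or, iff_true]
    exact ⟨0, by simp [conjSum, hx4]⟩
  obtain ⟨h1, h2⟩ := conjSum_bounds h.2
  have hi := h.1 i List.mem_cons_self
  have hpos : 0 < (-ψ) ^ (i + 2) := pow_pos hx0 _
  simp only [reduceCtorEq, false_or, List.headD_cons]
  constructor
  · rintro ⟨t, ht0, ht1⟩
    rcases Nat.even_or_odd i with he | ho
    · exfalso
      -- The sum lies in (-x², 0) with x = -ψ, and x² + x³ = x < 1, so `t` would lie strictly
      -- between 0 and 1.
      rw [he.add_one.neg_one_pow] at h1 h2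
      have hi2 : 2 ≤ i := by grind
      have : (-ψ) ^ i ≤ (-ψ) ^ 2 := pow_le_pow_of_le_one hx0.le hx1.le hi2
      have a1 : (0 : ℝ) < t := by linarith
      have a2 : (t : ℝ) < 1 := by linarith
      have a1' : 0 < t := by exact_mod_cast a1
      have a2' : t < 1 := by exact_mod_cast a2
      omega
    · refine ⟨ho, ?_⟩
      by_contra hlt
      -- Here the sum lies in (x³, x), which puts `t` strictly between -1 and 0.
      have hi1 : i = 1 := by grind
      subst hi1
      rw [ho.add_one.neg_one_pow] at h1 h2
      norm_num at h1 h2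
      have a1 : (-1 : ℝ) < t := by linarith
      have a2 : (t : ℝ) < 0 := by linarith
      have a1' : -1 < t := by exact_mod_cast a1
      have a2' : t < 0 := by exact_mod_cast a2
      omega
  · rintro ⟨ho, h3⟩
    rw [ho.add_one.neg_one_pow] at h1 h2
    have : (-ψ) ^ i ≤ (-ψ) ^ 3 := pow_le_pow_of_le_one hx0.le hx1.le h3
    exact ⟨0, by push_cast; linarith, by push_cast; linarith⟩

open Real goldenRatio in
theorem exists_floor_add_floor_iff (n : ℕ) :
    (∃ m : ℕ, (n : ℤ) = ⌊(m : ℝ) * φ⌋ + ⌊(m : ℝ) * φ ^ 2⌋) ↔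
      ∃ t : ℤ, t + conjSum (Z n) ∈ Set.Ico 0 ((-ψ) ^ 3) := by
  obtain ⟨s, hs⟩ := exists_conjSum_eq (Z n)
  rw [(Z_spec n).2] at hs
  have hφ := goldenRatio_sq
  have hψ : ψ = 1 - φ := one_sub_goldenConj.symm
  have hφ1 := one_lt_goldenRatio
  have hx3 : (-ψ) ^ 3 = 2 * φ - 3 := by
    rw [hψ]; linear_combination (φ - 2) * hφ
  have hx4 : 0 < (-ψ) ^ 3 := pow_pos (neg_pos.2 goldenConj_neg) 3
  have hfl : ∀ m : ℕ, ⌊(m : ℝ) * φ ^ 2⌋ = ⌊(m : ℝ) * φ⌋ + m := fun m => by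
    rw [hφ, mul_add, mul_one, Int.floor_add_natCast]
  have key : ∀ (m a : ℝ), (n : ℝ) = 2 * a + m →
      2 * m + 3 * a - φ * n = (-ψ) ^ 3 * (m * φ - a) := fun m a h => by
    rw [hx3, h]; linear_combination -2 * m * hφ
  constructor
  · rintro ⟨m, hm⟩
    rw [hfl] at hm
    generalize ha : ⌊(m : ℝ) * φ⌋ = a at hm
    obtain ⟨ha1, ha2⟩ := Int.floor_eq_iff.1 ha
    have hn : (n : ℝ) = 2 * a + m := by
      have : (n : ℤ) = 2 * a + m := by omega
      exact_mod_cast this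
    refine ⟨2 * m + 3 * a - s, ?_⟩
    have : ((2 * m + 3 * a - s : ℤ) : ℝ) + conjSum (Z n) = (-ψ) ^ 3 * (m * φ - a) := by
      rw [hs, ← key m a hn]; push_cast; ring
    rw [this]
    exact ⟨mul_nonneg hx4.le (by linarith), mul_lt_of_lt_one_right hx4 (by linarith)⟩
  · rintro ⟨t, ht0, ht1⟩
    -- These witnesses solve the unimodular system n = 2a + m, s + t = 2m + 3a.
    obtain ⟨m, hm⟩ : ∃ m : ℤ, m = 2 * (s + t) - 3 * n := ⟨_, rfl⟩
    obtain ⟨a, ha⟩ : ∃ a : ℤ, a = 2 * n - (s + t) := ⟨_, rfl⟩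
    have hn : (n : ℝ) = 2 * a + m := by
      have : (n : ℤ) = 2 * a + m := by omega
      exact_mod_cast this
    have ht : (t : ℝ) + conjSum (Z n) = (-ψ) ^ 3 * (m * φ - a) := by
      rw [hs, ← key m a hn, hm, ha]; push_cast; ring
    rw [ht] at ht0 ht1
    have h0 : 0 ≤ m * φ - a := nonneg_of_mul_nonneg_right ht0 hx4
    have h1 : m * φ - a < 1 := by
      by_contra hc
      have := mul_le_mul_of_nonneg_left (not_lt.1 hc) hx4.le
      linarith
    -- Since a ≤ mφ, a negative `m` would give n = 2a + m < 0.
    have hm0 : 0 ≤ m := by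
      by_contra hc
      have hm1 : (m : ℝ) ≤ -1 := by exact_mod_cast (by omega : m ≤ -1)
      have hn0 : (0 : ℝ) ≤ n := Nat.cast_nonneg n
      nlinarith
    lift m to ℕ using hm0
    refine ⟨m, ?_⟩
    have hfloor : ⌊(m : ℝ) * φ⌋ = a := by
      rw [Int.floor_eq_iff]
      push_cast at h0 h1
      constructor <;> linarith
    rw [hfl, hfloor]
    omega

/-! ### Least elements of the fibres and essential numbers -/

theorem proj_fSum_eps {L : List (List ℕ)} (hL : IsMultiVec 1 L) : proj (fSum (eps L)) = p L := by
  rw [proj, Z_fSum (hL.isTwoPartition_eps le_rfl), multiVec_eps hL le_rfl]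

theorem isLeast_fSum_eps_codeWord (γ : Gam) :
    IsLeast (proj ⁻¹' {γ}) (fSum (eps (codeWord γ))) := by
  constructor
  · rw [Set.mem_preimage, Set.mem_singleton_iff,
      proj_fSum_eps ((isMultiVec_codeWord γ).mono one_le_two), p_codeWord]
  · intro n hn
    obtain ⟨hZ, hn'⟩ := Z_spec n
    rw [Set.mem_preimage, Set.mem_singleton_iff, proj] at hn
    calc fSum (eps (codeWord γ)) ≤ fSum (eps (multiVec (Z n))) := by
          rw [← hn]; exact fSum_eps_codeWord_le (isMultiVec_multiVec hZ)
      _ ≤ fSum (Z n) := fSum_eps_multiVec_le hZ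
      _ = n := hn'

/-- `codeWord` and `p` are mutually inverse between words and multivectors with all entries at least
2, so the latter parametrise the essential numbers. -/
theorem isEssential_iff_exists (n : ℕ) :
    IsEssential n ↔ ∃ L, IsMultiVec 2 L ∧ n = fSum (eps L) := by
  constructor
  · rintro ⟨γ, h⟩
    exact ⟨_, isMultiVec_codeWord γ, h.unique (isLeast_fSum_eps_codeWord γ)⟩
  · rintro ⟨L, hL, rfl⟩
    refine ⟨p L, ?_⟩
    have := isLeast_fSum_eps_codeWord (p L)
    rwa [codeWord_p hL] at this

theorem Z_eq_nil_iff {n : ℕ} : Z n = [] ↔ n = 0 := by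
  refine ⟨fun h => ?_, fun h => by simp [h, Z]⟩
  rw [← (Z_spec n).2, h]
  rfl

theorem isEssential_iff_mu₁ (n : ℕ) : IsEssential n ↔ n = 0 ∨ (Odd (mu₁ n) ∧ 3 ≤ mu₁ n) := by
  rw [isEssential_iff_exists]
  constructor
  · rintro ⟨L, hL, rfl⟩
    rw [← Z_eq_nil_iff, mu₁, Z_fSum (hL.isTwoPartition_eps one_le_two)]
    rcases hL.exists_epsAux_eq_cons' 0 with h | ⟨j, I, h, hj, hp⟩
    · exact .inl h
    · rw [eps, h, List.headD_cons, Nat.odd_iff]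
      exact .inr ⟨by omega, by omega⟩
  · rintro (rfl | ⟨ho, h3⟩)
    · exact ⟨[], .nil 2, rfl⟩
    · obtain ⟨hZ, hn⟩ := Z_spec n
      rcases hI : Z n with _ | ⟨i, I⟩
      · simp [mu₁, hI] at h3
      · rw [mu₁, hI, List.headD_cons] at ho h3
        rw [hI] at hZ hn
        -- An index i ≥ 3 makes the first entry ⌊(i - 1)/2⌋ + 1 at least 2.
        refine ⟨multiVec (i :: I), isMultiVec_multiVecFrom hZ.2 (by omega), ?_⟩
        rw [eps_multiVec_of_odd hZ ho, hn]

open Real in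
theorem isEssential_iff_floor (n : ℕ) : IsEssential n ↔
    ∃ m : ℕ, (n : ℤ) = ⌊(m : ℝ) * goldenRatio⌋ + ⌊(m : ℝ) * goldenRatio ^ 2⌋ := by
  rw [exists_floor_add_floor_iff, exists_add_conjSum_mem_iff (Z_spec n).1, isEssential_iff_mu₁,
    Z_eq_nil_iff, mu₁]

end FibPart

theorem theorem3p4 :
    (∀ γ : FibPart.Gam, γ ≠ 1 →
      IsLeast (FibPart.proj ⁻¹' {γ}) (FibPart.fSum (FibPart.eps (FibPart.codeWord γ)))) ∧
    (∀ n : ℕ, FibPart.IsEssential n ↔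
      n = 0 ∨ (Odd (FibPart.mu₁ n) ∧ 3 ≤ FibPart.mu₁ n)) ∧
    (∀ n : ℕ, FibPart.IsEssential n ↔
      ∃ m : ℕ, (n : ℤ) = ⌊(m : ℝ) * ((1 + √5) / 2)⌋ + ⌊(m : ℝ) * ((1 + √5) / 2) ^ 2⌋) :=
  ⟨fun γ _ => FibPart.isLeast_fSum_eps_codeWord γ, FibPart.isEssential_iff_mu₁,
    FibPart.isEssential_iff_floor⟩
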